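/- Let $q\in(0,1)$, $\theta=\min(q,1-q)$, $h\in(0,1]$, $T\ge 1$, and let $\mu$ be a probability measure on the action space $\mathcal A$. The expectile loss of a prediction $w$ for an outcome $v$ is $g(v,w)=(1-q)((v-w)_+)^2+q((w-v)_+)^2$, and for a distribution $D$ on $[0,1]$ let $\mathrm{EVaR}_q(D)=\arg\min_{w\in[0,1]}\mathbb E_{v\sim D}[g(v,w)]$. *Protocol.* In each round $t=1,\dots,T$ an environment, which may be adaptive to the history (the previous contexts, loss functions and actions), chooses a context $x_t$ and a conditional distribution $\mathbb P_{l_t}(\cdot\mid x_t)$ of a loss function $l_t:\mathcal A\to[0,1]$. The learner sees $x_t$, plays $a_t$ and observes $l_t(a_t)$; given the history and $x_t$, the function $l_t$ and the action $a_t$ are independent. Write $\rho_t(a)$ for $\mathrm{EVaR}_q$ of the conditional distribution of $l_t(a)$. Let $\mathcal F$ be a class of functions $\mathcal X\times\mathcal A\to[0,1]$, and assume realizability: there is one $f^*\in\mathcal F$ with $f^*(x_t,a)=\rho_t(a)$ for all $t$ and $a$, whatever the history and the context. *Oracles.* The online regression oracle produces in round $t$, from the observations $(x_s,a_s,l_s(a_s))_{s<t}$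 and $x_t$, a function $\hat f_t$ in a class $\mathcal G$ of functions $\mathcal X\times\mathcal A\to[0,1]$ (for instance $\mathcal G=\mathcal F$), and on every sequence of contexts $x_t$, actions $a_t$ and outcomes $v_t\in[0,1]$ it satisfies $\sum_{t=1}^T\big(g(v_t,\hat f_t(x_t,a_t))-g(v_t,f(x_t,a_t))\big)\le R$ for all $f\in\mathcal F$, where $R=\mathrm{Reg}_{\mathrm{EVaR}_q}(T)$ does not depend on the sequence. For every $\delta>0$, $f\in\mathcal G$ and context $x$, the randomized optimization oracle outputs an action $\hat a$ with $\mathbb E_{\hat a}\,\mathbb E_{a\sim\mu}[\max(0,f(x,\hat a)-f(x,a))]\le\delta$. *Algorithm with parameter $\gamma>0$.* In round $t$ obtain $\hat f_t$ from the regression oracle, obtain $\hat a_t$ from the optimization oracle for $\hat f_t(x_t,\cdot)$ with accuracy $\delta=\frac1{4\theta\gamma}$, and sample $a_t$ from $(1-\tilde M(\mathcal A))\,\mathbf 1_{\hat a_t}+\tilde M$, where $\frac{d\tilde M}{d\mu}(a)=\frac1{1+4\theta\gamma h\max(0,\hat f_t(x_t,a)-\hat f_t(x_t,\hat a_t))}$.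 *Regret.* Let $P_t$ be the distribution of $a_t$ given the history and $x_t$, and $$\mathrm{Reg}_{CB}^{(h,\mu)}(T)=\sum_{t=1}^T\Big(\mathbb E_{a\sim P_t}[\rho_t(a)]-\inf_{Q:\ dQ/d\mu\le 1/h}\mathbb E_{a\sim Q}[\rho_t(a)]\Big),$$ where $Q$ ranges over probability measures absolutely continuous with respect to $\mu$. **Theorem.** The expectation over the interaction satisfies $$\mathbb E\,\mathrm{Reg}_{CB}^{(h,\mu)}(T)=O\Big(\tfrac1\theta\sqrt{\tfrac1h\,T\,R}\Big)$$ with a universal constant. Precisely, $\mathrm{Reg}_{CB}^{(h,\mu)}(T)$ is integrable for both choices of $\gamma$ below, and: 1. with $\gamma=\sqrt{\dfrac{3T}{h\,(16+12\theta(1+R))}}$ one has $\mathbb E\,\mathrm{Reg}_{CB}^{(h,\mu)}(T)\le\dfrac1\theta\sqrt{\dfrac{3T}{h}\,\big(4+3\theta(1+R)\big)}$; 2. if $R>0$, then with $\gamma=\sqrt{\dfrac{3T}{4\theta hR}}$ one has $\mathbb E\,\mathrm{Reg}_{CB}^{(h,\mu)}(T)\le\sqrt3\cdot\dfrac1\theta\sqrt{\dfrac1h\,T\,R}$.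 -/

import Mathlib

open MeasureTheory ProbabilityTheory Set

noncomputable section

namespace RiskCB

/-! ### Expectiles -/

/-- The expectile loss `(1 - q) ((v - w)₊)² + q ((w - v)₊)²` of the prediction `w` for the
outcome `v`. -/
def expectileLoss (q v w : ℝ) : ℝ :=
  (1 - q) * max (v - w) 0 ^ 2 + q * max (w - v) 0 ^ 2

/-- `w` minimizes the expected expectile loss over `[0, 1]`. -/
def IsExpectile (q : ℝ) (D : Measure ℝ) (w : ℝ) : Prop :=
  w ∈ Icc (0 : ℝ) 1 ∧ IsMinOn (fun w' => ∫ v, expectileLoss q v w' ∂D) (Icc 0 1) w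

/-- The risk measure `EVaR_q(D) = argmin_{w ∈ [0,1]} E_{v ∼ D} [expectileLoss q v w]` of a
distribution `D` of losses.  For `0 < q < 1` and a probability measure `D` on `[0, 1]` the
minimizer exists and is unique. -/
def EVaR (q : ℝ) (D : Measure ℝ) : ℝ :=
  Classical.epsilon (IsExpectile q D)

/-! ### The protocol -/

/-- The history of the first `t` rounds: contexts, (names of) loss functions, actions. -/
abbrev History (X A S : Type*) (t : ℕ) : Type _ := Fin t → X × S × A

/-- An adaptive environment.  A point `s : S` names the loss function `loss s : A → [0, 1]`.
In round `t` (counted from `0`) the context is drawn from `context t` given the history, and then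
the loss function from `lossLaw t` given the history and the context. -/
structure Environment (X A S : Type*) [MeasurableSpace X] [MeasurableSpace A]
    [MeasurableSpace S] where
  loss : S → A → ℝ
  measurable_loss : Measurable fun p : S × A => loss p.1 p.2
  loss_mem : ∀ s a, loss s a ∈ Icc (0 : ℝ) 1
  context : ∀ t : ℕ, Kernel (History X A S t) X
  context_markov : ∀ t, IsMarkovKernel (context t)
  lossLaw : ∀ t : ℕ, Kernel (History X A S t × X) S
  lossLaw_markov : ∀ t, IsMarkovKernel (lossLaw t)

/-- A class of regression functions `X × A → [0, 1]`, named by the points of `Φ`. -/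
structure FunctionClass (Φ X A : Type*) [MeasurableSpace Φ] [MeasurableSpace X]
    [MeasurableSpace A] where
  eval : Φ → X → A → ℝ
  measurable_eval : Measurable fun p : (Φ × X) × A => eval p.1.1 p.1.2 p.2
  eval_mem : ∀ φ x a, eval φ x a ∈ Icc (0 : ℝ) 1

/-- An online regression oracle: in round `t` it sees the earlier contexts, actions and realized
losses of these actions, and the current context, and outputs a regression function. -/
structure RegressionOracle (Φ X A : Type*) [MeasurableSpace Φ] [MeasurableSpace X]
    [MeasurableSpace A] where
  predict : ∀ t : ℕ, (Fin t → X × A × ℝ) → X → Φ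
  measurable_predict : ∀ t, Measurable fun p : (Fin t → X × A × ℝ) × X => predict t p.1 p.2

/-- A randomized optimization oracle for the fixed reference measure: given an accuracy, a
regression function and a context, a distribution over actions. -/
structure OptimizationOracle (Φ X A : Type*) [MeasurableSpace Φ] [MeasurableSpace X]
    [MeasurableSpace A] where
  choose : ℝ → Kernel (Φ × X) A
  choose_markov : ∀ δ, IsMarkovKernel (choose δ)

attribute [instance] Environment.context_markov Environment.lossLaw_markov
  OptimizationOracle.choose_markov

section Setting

variable {X A S Φ : Type*} [MeasurableSpace X] [MeasurableSpace A] [MeasurableSpace S]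
  [MeasurableSpace Φ]

/-- The regression oracle has regret at most `R` after `T` rounds under the expectile loss, on
every sequence of contexts, actions and losses in `[0, 1]`, against every function of the
benchmark class `𝓕`. -/
def RegressionOracle.HasRegretBound (O : RegressionOracle Φ X A) (F : FunctionClass Φ X A)
    (𝓕 : Set Φ) (q : ℝ) (T : ℕ) (R : ℝ) : Prop :=
  ∀ z : Fin T → X × A × ℝ, (∀ t, (z t).2.2 ∈ Icc (0 : ℝ) 1) → ∀ φ ∈ 𝓕,
    ∑ t : Fin T,
      (expectileLoss q (z t).2.2
          (F.eval (O.predict t (fun i => z (Fin.castLE t.isLt.le i)) (z t).1) (z t).1 (z t).2.1)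
        - expectileLoss q (z t).2.2 (F.eval φ (z t).1 (z t).2.1)) ≤ R

/-- The optimization oracle finds minimizers up to the error `δ` relative to `μ`, in expectation
over its own randomness. -/
def OptimizationOracle.IsAccurate (P : OptimizationOracle Φ X A) (F : FunctionClass Φ X A)
    (μ : Measure A) : Prop :=
  ∀ δ : ℝ, 0 < δ → ∀ (φ : Φ) (x : X),
    ∫ b, (∫ a, max 0 (F.eval φ x b - F.eval φ x a) ∂μ) ∂(P.choose δ (φ, x)) ≤ δ

/-- The conditional distribution of the loss of the action `a` in round `t`. -/
def Environment.lossDist (E : Environment X A S) (t : ℕ) (H : History X A S t) (x : X) (a : A) :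
    Measure ℝ :=
  (E.lossLaw t (H, x)).map fun s => E.loss s a

/-- Realizability during the first `T` rounds: one function of `𝓕` gives, in every round, for
every history, context and action, the `EVaR` of the conditional loss distribution. -/
def Environment.Realizable (E : Environment X A S) (F : FunctionClass Φ X A) (𝓕 : Set Φ)
    (q : ℝ) (T : ℕ) : Prop :=
  ∃ φ ∈ 𝓕, ∀ t < T, ∀ (H : History X A S t) (x : X) (a : A),
    F.eval φ x a = EVaR q (E.lossDist t H x a)

/-! ### The algorithm -/

/-- The parameter `θ = min (q, 1 - q)`. -/
def theta (q : ℝ) : ℝ := min q (1 - q)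

/-- The sub-probability measure with density
`1 / (1 + 4 θ γ h max (0, f a - f b))` with respect to `μ`. -/
def exploration (q h γ : ℝ) (μ : Measure A) (f : A → ℝ) (b : A) : Measure A :=
  μ.withDensity fun a =>
    ENNReal.ofReal (1 / (1 + 4 * theta q * γ * h * max 0 (f a - f b)))

/-- The smoothing distribution: the exploration measure, with the missing mass put on the
approximate minimizer `b`. -/
def contAL (q h γ : ℝ) (μ : Measure A) (f : A → ℝ) (b : A) : Measure A :=
  (1 - exploration q h γ μ f b univ) • Measure.dirac b + exploration q h γ μ f b

lemma measurable_contAL (q h γ : ℝ) (μ : Measure A) [SFinite μ] (F : FunctionClass Φ X A) :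
    Measurable fun p : (Φ × X) × A => contAL q h γ μ (F.eval p.1.1 p.1.2) p.2 := by
  have hd : Measurable fun p : ((Φ × X) × A) × A =>
      ENNReal.ofReal (1 / (1 + 4 * theta q * γ * h *
        max 0 (F.eval p.1.1.1 p.1.1.2 p.2 - F.eval p.1.1.1 p.1.1.2 p.1.2))) := by
    have h1 := F.measurable_eval.comp
      (Measurable.prodMk (measurable_fst.comp measurable_fst) measurable_snd :
        Measurable fun p : ((Φ × X) × A) × A => (p.1.1, p.2))
    have h2 := F.measurable_eval.comp
      (measurable_fst : Measurable fun p : ((Φ × X) × A) × A => p.1)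
    exact (measurable_const.div (measurable_const.add (measurable_const.mul
      (measurable_const.max (h1.sub h2))))).ennreal_ofReal
  have he : ∀ s : Set A, MeasurableSet s → Measurable fun p : (Φ × X) × A =>
      exploration q h γ μ (F.eval p.1.1 p.1.2) p.2 s := by
    intro s hs
    simp only [exploration, withDensity_apply _ hs]
    exact hd.lintegral_prod_right'
  refine Measure.measurable_of_measurable_coe _ fun s hs => ?_
  simp only [contAL, Measure.coe_add, Measure.coe_smul, Pi.add_apply, Pi.smul_apply, smul_eq_mul,
    Measure.dirac_apply' _ hs]
  exact ((measurable_const.sub (he _ MeasurableSet.univ)).mul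
    ((measurable_one.indicator hs).comp measurable_snd)).add (he s hs)

/-- `contAL` as a kernel in the regression function, the context and the approximate minimizer. -/
def contALKernel (q h γ : ℝ) (μ : Measure A) [SFinite μ] (F : FunctionClass Φ X A) :
    Kernel ((Φ × X) × A) A where
  toFun p := contAL q h γ μ (F.eval p.1.1 p.1.2) p.2
  measurable' := measurable_contAL q h γ μ F

/-- What the regression oracle has observed: contexts, actions, and the losses of these
actions. -/
def Environment.observe (E : Environment X A S) {t : ℕ} (H : History X A S t) :
    Fin t → X × A × ℝ :=
  fun i => ((H i).1, (H i).2.2, E.loss (H i).2.1 (H i).2.2)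

lemma Environment.measurable_observe (E : Environment X A S) (t : ℕ) :
    Measurable (E.observe : History X A S t → Fin t → X × A × ℝ) := by
  refine measurable_pi_lambda _ fun i => ?_
  have hi : Measurable fun H : History X A S t => H i := measurable_pi_apply i
  exact hi.fst.prodMk (hi.snd.snd.prodMk (E.measurable_loss.comp hi.snd))

/-- The action distribution of the algorithm in round `t` given the history and the context `x`:
obtain a regression function from the regression oracle, then an approximate minimizer `b` from
the optimization oracle with accuracy `1 / (4 θ γ)`, then sample the action from `contAL`. -/
def actionLaw (E : Environment X A S) (F : FunctionClass Φ X A) (O : RegressionOracle Φ X A)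
    (P : OptimizationOracle Φ X A) (μ : Measure A) [SFinite μ] (q h γ : ℝ) (t : ℕ) :
    Kernel (History X A S t × X) A :=
  (contALKernel q h γ μ F ∘ₖ (Kernel.id ×ₖ P.choose (1 / (4 * theta q * γ)))).comap
    (fun p : History X A S t × X => (O.predict t (E.observe p.1) p.2, p.2))
    (((O.measurable_predict t).comp
      (((E.measurable_observe t).comp measurable_fst).prodMk measurable_snd)).prodMk
        measurable_snd)

/-- One round: the context, and then, independently given the history and the context, the loss
function and the action. -/
def roundLaw (E : Environment X A S) (F : FunctionClass Φ X A) (O : RegressionOracle Φ X A)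
    (P : OptimizationOracle Φ X A) (μ : Measure A) [SFinite μ] (q h γ : ℝ) (t : ℕ) :
    Kernel (History X A S t) (X × S × A) :=
  E.context t ⊗ₖ (E.lossLaw t ×ₖ actionLaw E F O P μ q h γ t)

/-- The law of the history of the first `t` rounds when the algorithm plays against the
environment. -/
def historyLaw (E : Environment X A S) (F : FunctionClass Φ X A) (O : RegressionOracle Φ X A)
    (P : OptimizationOracle Φ X A) (μ : Measure A) [SFinite μ] (q h γ : ℝ) :
    (t : ℕ) → Measure (History X A S t)
  | 0 => Measure.dirac Fin.elim0
  | t + 1 => (historyLaw E F O P μ q h γ t ⊗ₘ roundLaw E F O P μ q h γ t).map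
      fun p => Fin.snoc (α := fun _ => X × S × A) p.1 p.2

/-! ### Smoothed regret -/

/-- The action distributions `Q` with `dQ/dμ ≤ 1/h`. -/
def smoothComparators (μ : Measure A) (h : ℝ) : Set (Measure A) :=
  {Q | IsProbabilityMeasure Q ∧ Q ≪ μ ∧ ∀ᵐ a ∂μ, Q.rnDeriv μ a ≤ ENNReal.ofReal (1 / h)}

/-- The smoothed conditional regret of round `t` given the history and the context `x`. -/
def roundRegret (E : Environment X A S) (F : FunctionClass Φ X A) (O : RegressionOracle Φ X A)
    (P : OptimizationOracle Φ X A) (μ : Measure A) [SFinite μ] (q h γ : ℝ) (t : ℕ)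
    (H : History X A S t) (x : X) : ℝ :=
  (∫ a, EVaR q (E.lossDist t H x a) ∂(actionLaw E F O P μ q h γ t (H, x)))
    - ⨅ Q : smoothComparators μ h, ∫ a, EVaR q (E.lossDist t H x a) ∂(Q : Measure A)

/-- The smoothed conditional regret over `T` rounds, as a function of the realized history. -/
def regret (E : Environment X A S) (F : FunctionClass Φ X A) (O : RegressionOracle Φ X A)
    (P : OptimizationOracle Φ X A) (μ : Measure A) [SFinite μ] (q h γ : ℝ) (T : ℕ)
    (H : History X A S T) : ℝ :=
  ∑ t : Fin T, roundRegret E F O P μ q h γ t (fun i => H (Fin.castLE t.isLt.le i)) (H t).1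

/-- The expectation of the regret over the interaction of algorithm and environment exists and is
at most `B`. -/
def ExpectedRegretLE (E : Environment X A S) (F : FunctionClass Φ X A)
    (O : RegressionOracle Φ X A) (P : OptimizationOracle Φ X A) (μ : Measure A) [SFinite μ]
    (q h γ : ℝ) (T : ℕ) (B : ℝ) : Prop :=
  Integrable (regret E F O P μ q h γ T) (historyLaw E F O P μ q h γ T) ∧
    ∫ H, regret E F O P μ q h γ T H ∂(historyLaw E F O P μ q h γ T) ≤ B

end Setting

end RiskCB

end

/-!
The expectile loss is strongly convex with modulus `2θ`, so the excess loss of a prediction `w` over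
the expectile `ρ` is at least `θ (w - ρ) ^ 2`, and the regret of the regression oracle controls the
squared prediction errors at the actions played. The density `1 / (1 + 4θγh max(0, f̂ a - f̂ b))` is
chosen so that, against every comparator with `dQ/dμ ≤ 1/h`, the smoothed regret of a round is at
most `θγ` times the expected squared error plus `3 / (4θγh)`. Summing over the rounds, the expected
regret is at most `3T / (4θγh) + γR`, and the two choices of `γ` balance the two terms.

The regret contains an infimum over comparators, whose measurability in the context comes from the
duality `inf_Q ∫ f dQ = sup_c (c - (1/h) ∫ max(0, c - f) dμ)`, where rational `c` suffice.
-/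

namespace RiskCB

section Integral

variable {Ω : Type*} [MeasurableSpace Ω] {ν : Measure Ω} [IsProbabilityMeasure ν]

lemma integral_mem_Icc {f : Ω → ℝ} {a b : ℝ} (hf : AEMeasurable f ν)
    (hab : ∀ᵐ ω ∂ν, f ω ∈ Icc a b) : ∫ ω, f ω ∂ν ∈ Icc a b :=
  (convex_Icc a b).integral_mem isClosed_Icc hab (.of_mem_Icc a b hf hab)

end Integral

/-! ### Uniform convexity -/

section UniformConvexity

variable {E : Type*} [NormedAddCommGroup E] [NormedSpace ℝ E] {s : Set E} {φ : ℝ → ℝ}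

lemma uniformConvexOn_integral {Ω : Type*} [MeasurableSpace Ω] {ν : Measure Ω}
    [IsProbabilityMeasure ν] {f : Ω → E → ℝ} (hf : ∀ᵐ ω ∂ν, UniformConvexOn s φ (f ω))
    (hint : ∀ x ∈ s, Integrable (fun ω => f ω x) ν) :
    UniformConvexOn s φ fun x => ∫ ω, f ω x ∂ν := by
  have hs : Convex ℝ s := hf.exists.choose_spec.1
  refine ⟨hs, fun x hx y hy a b ha hb hab => ?_⟩
  have hax : Integrable (fun ω => a • f ω x) ν := (hint x hx).smul a
  have hby : Integrable (fun ω => b • f ω y) ν := (hint y hy).smul b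
  calc ∫ ω, f ω (a • x + b • y) ∂ν
      ≤ ∫ ω, (a • f ω x + b • f ω y - a * b * φ ‖x - y‖) ∂ν :=
        integral_mono_ae (hint _ (hs hx hy ha hb hab)) ((hax.fun_add hby).sub (integrable_const _))
          (hf.mono fun ω hω => hω.2 hx hy ha hb hab)
    _ = a • ∫ ω, f ω x ∂ν + b • ∫ ω, f ω y ∂ν - a * b * φ ‖x - y‖ := by
        rw [integral_sub (hax.fun_add hby) (integrable_const _), integral_add hax hby,
          integral_smul, integral_smul, integral_const, probReal_univ, one_smul]

lemma le_sub_of_uniformConvexOn_of_isMinOn {f : E → ℝ} {x y : E} (hf : UniformConvexOn s φ f)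
    (hx : x ∈ s) (hmin : IsMinOn f s x) (hy : y ∈ s) : φ ‖x - y‖ ≤ f y - f x := by
  have hsegment : ∀ a ∈ Ico (0 : ℝ) 1, a * φ ‖x - y‖ ≤ f y - f x := by
    rintro a ⟨ha0, ha1⟩
    have hb : 0 < 1 - a := sub_pos.2 ha1
    have hab : a + (1 - a) = 1 := by ring
    have hle := (hmin (hf.1 hx hy ha0 hb.le hab)).trans (hf.2 hx hy ha0 hb.le hab)
    rw [smul_eq_mul, smul_eq_mul] at hle
    exact le_of_mul_le_mul_left (by linarith) hb
  have hlim : Filter.Tendsto (fun a : ℝ => a * φ ‖x - y‖) (nhdsWithin 1 (Iio 1))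
      (nhds (1 * φ ‖x - y‖)) :=
    (continuous_mul_const _).continuousWithinAt
  rw [one_mul] at hlim
  exact le_of_tendsto hlim (Filter.mem_of_superset (Ico_mem_nhdsLT one_pos) hsegment)

end UniformConvexity

/-! ### Expectiles -/

lemma theta_pos {q : ℝ} (hq0 : 0 < q) (hq1 : q < 1) : 0 < theta q :=
  lt_min hq0 (sub_pos.2 hq1)

section Expectile

variable {q : ℝ}

@[fun_prop]
lemma continuous_expectileLoss {Y : Type*} [TopologicalSpace Y] {v w : Y → ℝ} (hv : Continuous v)
    (hw : Continuous w) : Continuous fun y => expectileLoss q (v y) (w y) := by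
  unfold expectileLoss; fun_prop

@[fun_prop]
lemma measurable_expectileLoss {Y : Type*} [MeasurableSpace Y] {v w : Y → ℝ} (hv : Measurable v)
    (hw : Measurable w) : Measurable fun y => expectileLoss q (v y) (w y) := by
  unfold expectileLoss; fun_prop

lemma expectileLoss_mem_Icc (hq : q ∈ Icc (0 : ℝ) 1) {v w : ℝ} (hv : v ∈ Icc (0 : ℝ) 1)
    (hw : w ∈ Icc (0 : ℝ) 1) : expectileLoss q v w ∈ Icc (0 : ℝ) 1 := by
  have sq_max_mem : ∀ x ≤ (1 : ℝ), max x 0 ^ 2 ∈ Icc (0 : ℝ) 1 := fun x hx =>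
    ⟨sq_nonneg _, pow_le_one₀ (le_max_right _ _) (max_le hx zero_le_one)⟩
  exact convex_Icc 0 1 (sq_max_mem (v - w) (by linarith [hv.2, hw.1]))
    (sq_max_mem (w - v) (by linarith [hv.1, hw.2])) (sub_nonneg.2 hq.2) hq.1
    (sub_add_cancel 1 q)

lemma expectileLoss_eq_theta_mul_sq_add (q v w : ℝ) :
    expectileLoss q v w = theta q * (w - v) ^ 2 + (1 - q - theta q) * max (v - w) 0 ^ 2
      + (q - theta q) * max (w - v) 0 ^ 2 := by
  unfold expectileLoss
  rcases le_total v w with hvw | hvw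
  · rw [max_eq_right (sub_nonpos.2 hvw), max_eq_left (sub_nonneg.2 hvw)]; ring
  · rw [max_eq_left (sub_nonneg.2 hvw), max_eq_right (sub_nonpos.2 hvw)]; ring

lemma convexOn_sq_max_zero {E : Type*} [AddCommGroup E] [Module ℝ E] {s : Set E} {f : E → ℝ}
    (hf : ConvexOn ℝ s f) : ConvexOn ℝ s fun x => max (f x) 0 ^ 2 :=
  (hf.sup (convexOn_const 0 hf.1)).pow (fun _ _ => le_max_right _ _) 2

lemma strongConvexOn_expectileLoss (q v : ℝ) :
    StrongConvexOn univ (2 * theta q) (expectileLoss q v) := by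
  have haffine (c d : ℝ) : ConvexOn ℝ univ fun w => c * w + d :=
    ((LinearMap.mulLeft ℝ c).convexOn convex_univ).add_const d
  have habove := (convexOn_sq_max_zero (haffine (-1) v)).smul
    (sub_nonneg.2 (min_le_right q (1 - q)) : 0 ≤ 1 - q - theta q)
  have hbelow := (convexOn_sq_max_zero (haffine 1 (-v))).smul
    (sub_nonneg.2 (min_le_left q (1 - q)) : 0 ≤ q - theta q)
  rw [strongConvexOn_iff_convex]
  refine (((haffine (-(2 * theta q * v)) (theta q * v ^ 2)).add habove).add hbelow).congr ?_
  intro w _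
  simp only [Pi.add_apply, smul_eq_mul, expectileLoss_eq_theta_mul_sq_add, Real.norm_eq_abs,
    sq_abs]
  ring_nf

section Law

variable {D : Measure ℝ} [IsProbabilityMeasure D]

lemma integrable_expectileLoss (hq : q ∈ Icc (0 : ℝ) 1) (hD : ∀ᵐ v ∂D, v ∈ Icc (0 : ℝ) 1) {w : ℝ}
    (hw : w ∈ Icc (0 : ℝ) 1) : Integrable (fun v => expectileLoss q v w) D :=
  .of_mem_Icc 0 1 (by fun_prop) (hD.mono fun _ hv => expectileLoss_mem_Icc hq hv hw)

lemma isExpectile_EVaR (hq : q ∈ Icc (0 : ℝ) 1) (hD : ∀ᵐ v ∂D, v ∈ Icc (0 : ℝ) 1) :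
    IsExpectile q D (EVaR q D) := by
  have hcont : ContinuousOn (fun w => ∫ v, expectileLoss q v w ∂D) (Icc 0 1) :=
    continuousOn_of_dominated (bound := fun _ => 1)
      (fun w hw => (integrable_expectileLoss hq hD hw).aestronglyMeasurable)
      (fun w hw => hD.mono fun v hv => by
        have hmem := expectileLoss_mem_Icc hq hv hw
        rw [Real.norm_of_nonneg hmem.1]
        exact hmem.2)
      (integrable_const _) (ae_of_all _ fun v => by fun_prop)
  exact Classical.epsilon_spec (isCompact_Icc.exists_isMinOn (nonempty_Icc.2 zero_le_one) hcont)

lemma theta_mul_sq_sub_EVaR_le (hq : q ∈ Icc (0 : ℝ) 1) (hD : ∀ᵐ v ∂D, v ∈ Icc (0 : ℝ) 1) {w : ℝ}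
    (hw : w ∈ Icc (0 : ℝ) 1) :
    theta q * (w - EVaR q D) ^ 2 ≤
      ∫ v, (expectileLoss q v w - expectileLoss q v (EVaR q D)) ∂D := by
  obtain ⟨hmem, hmin⟩ := isExpectile_EVaR hq hD
  have hconv : StrongConvexOn (Icc 0 1) (2 * theta q) fun w => ∫ v, expectileLoss q v w ∂D :=
    uniformConvexOn_integral
      (ae_of_all _ fun v => ⟨convex_Icc 0 1, fun _ _ _ _ =>
        (strongConvexOn_expectileLoss q v).2 (mem_univ _) (mem_univ _)⟩)
      fun _ => integrable_expectileLoss hq hD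
  have hle := le_sub_of_uniformConvexOn_of_isMinOn hconv hmem hmin hw
  rw [integral_sub (integrable_expectileLoss hq hD hw) (integrable_expectileLoss hq hD hmem)]
  rwa [mul_div_cancel_left₀ _ two_ne_zero, norm_sub_rev, Real.norm_eq_abs, sq_abs] at hle

end Law

end Expectile

/-! ### Smooth comparators -/

section Comparators

lemma exists_quantile (ν : Measure ℝ) [IsProbabilityMeasure ν] {p b : ℝ} (hp : 0 < p)
    (hb : p ≤ cdf ν b) : ∃ c, ν.real (Iio c) ≤ p ∧ p ≤ ν.real (Iic c) := by
  set S := {c | p ≤ cdf ν c}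
  have hbdd : BddBelow S := by
    obtain ⟨a, ha⟩ := ((tendsto_cdf_atBot ν).eventually (gt_mem_nhds hp)).exists
    exact ⟨a, fun c hc => le_of_lt ((monotone_cdf ν).reflect_lt (ha.trans_le hc))⟩
  refine ⟨sInf S, ?_, ?_⟩
  · have hleft : Function.leftLim (cdf ν) (sInf S) ≤ p :=
      le_of_tendsto ((monotone_cdf ν).tendsto_leftLim _) <| eventually_nhdsWithin_of_forall
        fun c hc => (not_le.1 fun hle => notMem_of_lt_csInf hc hbdd hle).le
    have hIio := (cdf ν).measure_Iio (tendsto_cdf_atBot ν) (sInf S)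
    rw [measure_cdf, sub_zero] at hIio
    rw [measureReal_def, hIio]
    exact ENNReal.toReal_le_of_le_ofReal hp.le (ENNReal.ofReal_le_ofReal hleft)
  · rw [← cdf_eq_real]
    refine ge_of_tendsto (((cdf ν).right_continuous _).mono_left
      (nhdsWithin_mono _ Ioi_subset_Ici_self)) <| eventually_nhdsWithin_of_forall fun c hc => ?_
    obtain ⟨s, hs, hsc⟩ := exists_lt_of_csInf_lt ⟨b, hb⟩ hc
    exact le_trans hs (monotone_cdf ν hsc.le)

variable {A : Type*} [MeasurableSpace A] {μ Q : Measure A} {h : ℝ} {f : A → ℝ}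

lemma mem_smoothComparators_iff [SigmaFinite μ] :
    Q ∈ smoothComparators μ h ↔ IsProbabilityMeasure Q ∧ Q ≤ ENNReal.ofReal (1 / h) • μ := by
  refine and_congr_right fun _ => ⟨fun ⟨hac, hd⟩ => ?_, fun hle => ⟨?_, ?_⟩⟩
  · rw [← Measure.withDensity_rnDeriv_eq Q μ hac, ← withDensity_const]
    exact withDensity_mono hd
  · exact Measure.absolutelyContinuous_of_le_smul hle
  · refine ae_le_of_forall_setLIntegral_le_of_sigmaFinite (Q.measurable_rnDeriv μ) fun s _ _ => ?_
    calc ∫⁻ a in s, Q.rnDeriv μ a ∂μ ≤ Q s := Measure.setLIntegral_rnDeriv_le s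
      _ ≤ (ENNReal.ofReal (1 / h) • μ) s := hle s
      _ = ∫⁻ _ in s, ENNReal.ofReal (1 / h) ∂μ := by simp

lemma integrable_of_mem_smoothComparators [SigmaFinite μ] (hQ : Q ∈ smoothComparators μ h)
    (hf : Integrable f μ) : Integrable f Q :=
  (hf.smul_measure ENNReal.ofReal_ne_top).mono_measure (mem_smoothComparators_iff.1 hQ).2

lemma integral_le_of_mem_smoothComparators [SigmaFinite μ] (hh : 0 < h)
    (hQ : Q ∈ smoothComparators μ h) (hf0 : 0 ≤ f) (hf : Integrable f μ) :
    ∫ a, f a ∂Q ≤ 1 / h * ∫ a, f a ∂μ := by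
  have hle := integral_mono_measure (mem_smoothComparators_iff.1 hQ).2 (ae_of_all _ hf0)
    (hf.smul_measure ENNReal.ofReal_ne_top)
  rwa [integral_smul_measure, ENNReal.toReal_ofReal (by positivity), smul_eq_mul] at hle

lemma integrable_hinge [IsFiniteMeasure μ] (hf : Integrable f μ) (c : ℝ) :
    Integrable (fun a => max 0 (c - f a)) μ :=
  (integrable_const 0).sup ((integrable_const c).sub hf)

variable [IsProbabilityMeasure μ]

lemma self_mem_smoothComparators (hh0 : 0 < h) (hh1 : h ≤ 1) : μ ∈ smoothComparators μ h := by
  refine mem_smoothComparators_iff.2 ⟨inferInstance, ?_⟩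
  conv_lhs => rw [← one_smul ENNReal μ]
  gcongr
  rwa [ENNReal.one_le_ofReal, le_div_iff₀ hh0, one_mul]

lemma sub_integral_hinge_le_integral (hh : 0 < h) (hf : Integrable f μ)
    (hQ : Q ∈ smoothComparators μ h) (c : ℝ) :
    c - 1 / h * ∫ a, max 0 (c - f a) ∂μ ≤ ∫ a, f a ∂Q := by
  have := hQ.1
  have hfQ := integrable_of_mem_smoothComparators hQ hf
  have hhinge := integrable_hinge hf c
  calc c - 1 / h * ∫ a, max 0 (c - f a) ∂μ
      ≤ c - ∫ a, max 0 (c - f a) ∂Q := by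
        gcongr
        exact integral_le_of_mem_smoothComparators hh hQ (fun _ => le_max_left _ _) hhinge
    _ = ∫ a, (c - max 0 (c - f a)) ∂Q := by
        rw [integral_sub (integrable_const c) (integrable_of_mem_smoothComparators hQ hhinge),
          integral_const, probReal_univ, one_smul]
    _ ≤ ∫ a, f a ∂Q :=
        integral_mono
          ((integrable_const c).sub (integrable_of_mem_smoothComparators hQ hhinge)) hfQ
          fun a => sub_le_comm.1 (le_max_right _ _)

lemma exists_measureReal_lt_add_mul_eq {b : ℝ} (hh0 : 0 < h) (hh1 : h ≤ 1) (hf : Measurable f)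
    (hfb : ∀ᵐ a ∂μ, f a ≤ b) :
    ∃ c, ∃ l ∈ Icc (0 : ℝ) 1, μ.real (f ⁻¹' Iio c) + l * μ.real (f ⁻¹' {c}) = h := by
  have := Measure.isProbabilityMeasure_map (μ := μ) hf.aemeasurable
  have hb : h ≤ cdf (μ.map f) b := by
    rwa [cdf_eq_real, map_measureReal_apply hf measurableSet_Iic, measureReal_def,
      (mem_ae_iff_prob_eq_one (hf measurableSet_Iic)).1 hfb, ENNReal.toReal_one]
  obtain ⟨c, hlt, hle⟩ := exists_quantile (μ.map f) hh0 hb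
  rw [← Iio_union_right, measureReal_union (by simp) (measurableSet_singleton c),
    map_measureReal_apply hf measurableSet_Iio,
    map_measureReal_apply hf (measurableSet_singleton c)] at hle
  rw [map_measureReal_apply hf measurableSet_Iio] at hlt
  obtain ⟨l, hl, hmass⟩ := intermediate_value_Icc zero_le_one
    (f := fun l : ℝ => μ.real (f ⁻¹' Iio c) + l * μ.real (f ⁻¹' {c})) (by fun_prop)
    ⟨by simpa using hlt, by simpa using hle⟩
  exact ⟨c, l, hl, hmass⟩

lemma smul_restrict_add_mem_smoothComparators {l : ℝ} {s t : Set A} (hh : 0 < h)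
    (hst : Disjoint s t) (ht : MeasurableSet t) (hl : l ∈ Icc (0 : ℝ) 1)
    (hmass : μ.real s + l * μ.real t = h) :
    ENNReal.ofReal (1 / h) • (μ.restrict s + ENNReal.ofReal l • μ.restrict t) ∈
      smoothComparators μ h := by
  refine mem_smoothComparators_iff.2 ⟨isProbabilityMeasure_iff_real.2 ?_, ?_⟩
  · have := (μ.restrict t).smul_finite (c := ENNReal.ofReal l) ENNReal.ofReal_ne_top
    rw [measureReal_ennreal_smul_apply, measureReal_add_apply, measureReal_ennreal_smul_apply,
      measureReal_restrict_apply_univ, measureReal_restrict_apply_univ, ENNReal.toReal_ofReal hl.1,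
      hmass, ENNReal.toReal_ofReal (by positivity), one_div_mul_cancel hh.ne']
  · gcongr
    calc μ.restrict s + ENNReal.ofReal l • μ.restrict t
        ≤ μ.restrict s + (1 : ENNReal) • μ.restrict t := by
          gcongr
          exact ENNReal.ofReal_le_one.2 hl.2
      _ = μ.restrict (s ∪ t) := by rw [one_smul, Measure.restrict_union hst ht]
      _ ≤ μ := Measure.restrict_le_self

lemma exists_mem_smoothComparators_integral_eq {b : ℝ} (hh0 : 0 < h) (hh1 : h ≤ 1)
    (hfm : Measurable f) (hf : Integrable f μ) (hfb : ∀ᵐ a ∂μ, f a ≤ b) :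
    ∃ Q ∈ smoothComparators μ h, ∃ c : ℝ,
      ∫ a, f a ∂Q = c - 1 / h * ∫ a, max 0 (c - f a) ∂μ := by
  obtain ⟨c, l, hl, hmass⟩ := exists_measureReal_lt_add_mul_eq hh0 hh1 hfm hfb
  set s := f ⁻¹' Iio c
  set t := f ⁻¹' {c}
  have hs : MeasurableSet s := hfm measurableSet_Iio
  have ht : MeasurableSet t := hfm (measurableSet_singleton c)
  have hst : Disjoint s t := Disjoint.preimage f (by simp)
  have hQ := smul_restrict_add_mem_smoothComparators hh0 hst ht hl hmass
  set Q := ENNReal.ofReal (1 / h) • (μ.restrict s + ENNReal.ofReal l • μ.restrict t)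
  refine ⟨Q, hQ, c, ?_⟩
  have := hQ.1
  have hhinge : ∫ a, max 0 (c - f a) ∂μ = ∫ a in s, (c - f a) ∂μ := by
    rw [← integral_indicator hs]
    congr with a
    by_cases ha : f a < c
    · rw [indicator_of_mem (show a ∈ s from ha), max_eq_right (sub_nonneg.2 ha.le)]
    · rw [indicator_of_notMem (show a ∉ s from ha), max_eq_left (sub_nonpos.2 (not_lt.1 ha))]
  have hzero : ∫ a in t, (c - f a) ∂μ = 0 :=
    setIntegral_eq_zero_of_forall_eq_zero fun a ha => sub_eq_zero.2 (Eq.symm ha)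
  have hgap : Integrable (fun a => c - f a) μ := (integrable_const c).sub hf
  have hQgap : ∫ a, (c - f a) ∂Q = 1 / h * ∫ a, max 0 (c - f a) ∂μ := by
    rw [integral_smul_measure, integral_add_measure hgap.restrict
      (hgap.restrict.smul_measure ENNReal.ofReal_ne_top), integral_smul_measure, hzero, smul_zero,
      add_zero, ← hhinge, ENNReal.toReal_ofReal (by positivity), smul_eq_mul]
  rw [integral_sub (integrable_const c) (integrable_of_mem_smoothComparators hQ hf),
    integral_const, probReal_univ, one_smul] at hQgap
  linarith

lemma iInf_smoothComparators_eq_iSup {b : ℝ} (hh0 : 0 < h) (hh1 : h ≤ 1) (hfm : Measurable f)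
    (hf : Integrable f μ) (hfb : ∀ᵐ a ∂μ, f a ≤ b) :
    ⨅ Q : smoothComparators μ h, ∫ a, f a ∂(Q : Measure A) =
      ⨆ c : ℚ, ((c : ℝ) - 1 / h * ∫ a, max 0 ((c : ℝ) - f a) ∂μ) := by
  have : Nonempty (smoothComparators μ h) := ⟨⟨μ, self_mem_smoothComparators hh0 hh1⟩⟩
  refine le_antisymm ?_ (ciSup_le fun c => le_ciInf fun Q =>
    sub_integral_hinge_le_integral hh0 hf Q.2 c)
  obtain ⟨Q, hQ, c, hc⟩ := exists_mem_smoothComparators_integral_eq hh0 hh1 hfm hf hfb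
  have hbelow : BddBelow (range fun Q : smoothComparators μ h => ∫ a, f a ∂(Q : Measure A)) :=
    ⟨_, forall_mem_range.2 fun Q => sub_integral_hinge_le_integral hh0 hf Q.2 0⟩
  have habove : BddAbove (range fun c : ℚ =>
      ((c : ℝ) - 1 / h * ∫ a, max 0 ((c : ℝ) - f a) ∂μ)) :=
    ⟨_, forall_mem_range.2 fun c => sub_integral_hinge_le_integral hh0 hf hQ c⟩
  refine (ciInf_le hbelow ⟨Q, hQ⟩).trans (le_of_forall_pos_le_add fun ε hε => ?_)
  obtain ⟨r, hcr, hrc⟩ := exists_rat_btwn (sub_lt_self c hε)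
  have hhinge : ∫ a, max 0 ((r : ℝ) - f a) ∂μ ≤ ∫ a, max 0 (c - f a) ∂μ :=
    integral_mono (integrable_hinge hf _) (integrable_hinge hf _) fun a => by
      dsimp only; gcongr
  calc ∫ a, f a ∂Q = c - 1 / h * ∫ a, max 0 (c - f a) ∂μ := hc
    _ ≤ (r - 1 / h * ∫ a, max 0 ((r : ℝ) - f a) ∂μ) + ε := by
        have := mul_le_mul_of_nonneg_left hhinge (by positivity : 0 ≤ 1 / h)
        linarith
    _ ≤ _ := by gcongr; exact le_ciSup habove r

lemma iInf_smoothComparators_mem_Icc {a b : ℝ} (hh0 : 0 < h) (hh1 : h ≤ 1) (hf : AEMeasurable f μ)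
    (hfab : ∀ᵐ x ∂μ, f x ∈ Icc a b) :
    ⨅ Q : smoothComparators μ h, ∫ x, f x ∂(Q : Measure A) ∈ Icc a b := by
  have hμ := self_mem_smoothComparators (μ := μ) hh0 hh1
  have : Nonempty (smoothComparators μ h) := ⟨⟨μ, hμ⟩⟩
  have hmem (Q : smoothComparators μ h) : ∫ x, f x ∂(Q : Measure A) ∈ Icc a b := by
    have := Q.2.1
    exact integral_mem_Icc (hf.mono_ac Q.2.2.1) (Q.2.2.1.ae_le hfab)
  exact ⟨le_ciInf fun Q => (hmem Q).1,
    (ciInf_le ⟨a, forall_mem_range.2 fun Q => (hmem Q).1⟩ ⟨μ, hμ⟩).trans (hmem ⟨μ, hμ⟩).2⟩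

lemma measurable_iInf_smoothComparators {Y : Type*} [MeasurableSpace Y] {f : Y → A → ℝ} {a b : ℝ}
    (hh0 : 0 < h) (hh1 : h ≤ 1) (hf : Measurable fun p : Y × A => f p.1 p.2)
    (hfab : ∀ y, ∀ᵐ x ∂μ, f y x ∈ Icc a b) :
    Measurable fun y => ⨅ Q : smoothComparators μ h, ∫ x, f y x ∂(Q : Measure A) := by
  simp only [iInf_smoothComparators_eq_iSup hh0 hh1 hf.of_uncurry_left
    (.of_mem_Icc a b hf.of_uncurry_left.aemeasurable (hfab _))
    ((hfab _).mono fun _ hx => hx.2)]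
  refine .iSup fun c => measurable_const.sub (measurable_const.mul ?_)
  exact (measurable_const.max (measurable_const.sub hf)).stronglyMeasurable.integral_prod_right
    |>.measurable

end Comparators

/-! ### The exploration distribution -/

section Exploration

variable {A : Type*} {k : ℝ} {f : A → ℝ} {b : A}

/-- The density of `exploration` with respect to the base measure, for `k = 4 θ γ h`. -/
noncomputable def explorationDensity (k : ℝ) (f : A → ℝ) (b a : A) : ℝ :=
  1 / (1 + k * max 0 (f a - f b))

lemma explorationDensity_pos (hk : 0 ≤ k) (f : A → ℝ) (b a : A) :
    0 < explorationDensity k f b a := by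
  unfold explorationDensity; positivity

lemma explorationDensity_le_one (hk : 0 ≤ k) (f : A → ℝ) (b a : A) :
    explorationDensity k f b a ≤ 1 :=
  div_le_one_of_le₀ (le_add_of_nonneg_right (by positivity)) (by positivity)

lemma explorationDensity_mul_max_le (hk : 0 < k) (f : A → ℝ) (b a : A) :
    explorationDensity k f b a * max 0 (f a - f b) ≤ 1 / k := by
  rw [explorationDensity, one_div_mul_eq_div, div_le_div_iff₀ (by positivity) hk]
  linarith

lemma le_mul_explorationDensity_mul_sq (hk : 0 < k) (f : A → ℝ) (b a : A) (x : ℝ) :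
    x ≤ k / 4 * (explorationDensity k f b a * x ^ 2) + 1 / k + max 0 (f a - f b) := by
  have hm := explorationDensity_pos hk.le f b a
  have hinv : 1 / k + max 0 (f a - f b) = 1 / (k * explorationDensity k f b a) := by
    unfold explorationDensity; field_simp
  have hsq : k / 4 * (explorationDensity k f b a * x ^ 2) + 1 / (k * explorationDensity k f b a) - x
      = (k * explorationDensity k f b a * x / 2 - 1) ^ 2 / (k * explorationDensity k f b a) := by
    field_simp; ring
  rw [add_assoc, hinv, ← sub_nonneg, hsq]
  positivity

variable [MeasurableSpace A] {μ : Measure A} {q h γ : ℝ}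

@[fun_prop]
lemma measurable_explorationDensity (hf : Measurable f) :
    Measurable (explorationDensity k f b) := by
  unfold explorationDensity; fun_prop

lemma exploration_le (hk : 0 ≤ 4 * theta q * γ * h) (f : A → ℝ) (b : A) :
    exploration q h γ μ f b ≤ μ := by
  conv_rhs => rw [← withDensity_one (μ := μ)]
  exact withDensity_mono (ae_of_all _ fun a =>
    ENNReal.ofReal_le_one.2 (explorationDensity_le_one hk f b a))

lemma integral_exploration (hk : 0 ≤ 4 * theta q * γ * h) (hf : Measurable f) (b : A) (g : A → ℝ) :
    ∫ a, g a ∂(exploration q h γ μ f b) =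
      ∫ a, explorationDensity (4 * theta q * γ * h) f b a * g a ∂μ := by
  have hdensity : exploration q h γ μ f b = μ.withDensity fun a =>
      ENNReal.ofReal (explorationDensity (4 * theta q * γ * h) f b a) := rfl
  rw [hdensity, integral_withDensity_eq_integral_toReal_smul (by fun_prop)
    (ae_of_all _ fun _ => ENNReal.ofReal_lt_top)]
  simp only [ENNReal.toReal_ofReal (explorationDensity_pos hk f b _).le, smul_eq_mul]

lemma integrable_contAL (hk : 0 ≤ 4 * theta q * γ * h) {g : A → ℝ} (hgm : Measurable g)
    (hg : Integrable g μ) (f : A → ℝ) (b : A) : Integrable g (contAL q h γ μ f b) :=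
  ((integrable_dirac' hgm.stronglyMeasurable enorm_lt_top).smul_measure
    (ENNReal.sub_ne_top ENNReal.one_ne_top)).add_measure (hg.mono_measure (exploration_le hk f b))

variable [IsProbabilityMeasure μ]

lemma isProbabilityMeasure_contAL (hk : 0 ≤ 4 * theta q * γ * h) (f : A → ℝ) (b : A) :
    IsProbabilityMeasure (contAL q h γ μ f b) := by
  refine ⟨?_⟩
  rw [contAL, Measure.add_apply, Measure.smul_apply, measure_univ (μ := Measure.dirac b),
    smul_eq_mul, mul_one]
  exact tsub_add_cancel_of_le ((exploration_le hk f b univ).trans measure_univ.le)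

lemma integral_contAL_le (hk : 0 < 4 * theta q * γ * h) (hfm : Measurable f) (hf : Integrable f μ)
    (b : A) :
    ∫ a, f a ∂(contAL q h γ μ f b) ≤ f b + 1 / (4 * theta q * γ * h) := by
  have := isProbabilityMeasure_contAL (μ := μ) hk.le f b
  have hgap : Integrable (fun a => f a - f b) (exploration q h γ μ f b) :=
    (hf.sub (integrable_const _)).mono_measure (exploration_le hk.le f b)
  have hgap_le : ∫ a, (f a - f b) ∂(contAL q h γ μ f b) ≤ 1 / (4 * theta q * γ * h) :=
    calc ∫ a, (f a - f b) ∂(contAL q h γ μ f b)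
        = ∫ a, (f a - f b) ∂(exploration q h γ μ f b) := by
          rw [contAL, integral_add_measure ((integrable_dirac' (by fun_prop)
              enorm_lt_top).smul_measure (ENNReal.sub_ne_top ENNReal.one_ne_top)) hgap,
            integral_smul_measure, integral_dirac' _ _ (by fun_prop), sub_self, smul_zero,
            zero_add]
      _ ≤ ∫ a, max 0 (f a - f b) ∂(exploration q h γ μ f b) :=
          integral_mono hgap ((integrable_zero _ _ _).sup hgap) fun a => le_max_right _ _
      _ = ∫ a, explorationDensity (4 * theta q * γ * h) f b a * max 0 (f a - f b) ∂μ :=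
          integral_exploration hk.le hfm b _
      _ ≤ ∫ _, 1 / (4 * theta q * γ * h) ∂μ :=
          integral_mono_of_nonneg (ae_of_all _ fun a =>
            mul_nonneg (explorationDensity_pos hk.le f b a).le (le_max_left _ _))
            (integrable_const _) (ae_of_all _ (explorationDensity_mul_max_le hk f b))
      _ = 1 / (4 * theta q * γ * h) := by rw [integral_const, probReal_univ, one_smul]
  rw [integral_sub (integrable_contAL hk.le hfm hf f b) (integrable_const _), integral_const,
    probReal_univ, one_smul] at hgap_le
  linarith

lemma integral_le_theta_mul_integral_sq_contAL (hκ : 0 < 4 * theta q * γ) (hh : 0 < h)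
    (hfm : Measurable f) (hf : Integrable f μ) (b : A) {Q : Measure A}
    (hQ : Q ∈ smoothComparators μ h) {φ : A → ℝ} (hφm : Measurable φ) (hφ : MemLp φ 2 μ) :
    ∫ a, φ a ∂Q ≤ theta q * γ * ∫ a, φ a ^ 2 ∂(contAL q h γ μ f b) + 1 / (4 * theta q * γ * h)
      + ∫ a, max 0 (f a - f b) ∂Q := by
  have := hQ.1
  set k := 4 * theta q * γ * h with hk_def
  have hk : 0 < k := mul_pos hκ hh
  have hgap : Integrable (fun a => max 0 (f a - f b)) Q :=
    integrable_of_mem_smoothComparators hQ ((integrable_const 0).sup (hf.sub (integrable_const _)))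
  have hweighted : Integrable (fun a => explorationDensity k f b a * φ a ^ 2) μ :=
    hφ.integrable_sq.mono' (by fun_prop) (ae_of_all _ fun a => by
      rw [Real.norm_of_nonneg (mul_nonneg (explorationDensity_pos hk.le f b a).le (sq_nonneg _))]
      exact mul_le_of_le_one_left (sq_nonneg _) (explorationDensity_le_one hk.le f b a))
  have hweightedQ := integrable_of_mem_smoothComparators hQ hweighted
  have hchange : ∫ a, explorationDensity k f b a * φ a ^ 2 ∂Q ≤
      1 / h * ∫ a, φ a ^ 2 ∂(contAL q h γ μ f b) :=
    calc ∫ a, explorationDensity k f b a * φ a ^ 2 ∂Q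
        ≤ 1 / h * ∫ a, explorationDensity k f b a * φ a ^ 2 ∂μ :=
          integral_le_of_mem_smoothComparators hh hQ (fun a =>
            mul_nonneg (explorationDensity_pos hk.le f b a).le (sq_nonneg _)) hweighted
      _ = 1 / h * ∫ a, φ a ^ 2 ∂(exploration q h γ μ f b) := by
          rw [integral_exploration hk.le hfm]
      _ ≤ 1 / h * ∫ a, φ a ^ 2 ∂(contAL q h γ μ f b) := by
          gcongr ?_ * ?_
          exact integral_mono_measure (Measure.le_add_left le_rfl)
            (ae_of_all _ fun a => sq_nonneg (φ a))
            (integrable_contAL hk.le (by fun_prop) hφ.integrable_sq f b)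
  have hscale : k / 4 * (1 / h * ∫ a, φ a ^ 2 ∂(contAL q h γ μ f b)) =
      theta q * γ * ∫ a, φ a ^ 2 ∂(contAL q h γ μ f b) := by rw [hk_def]; field_simp
  calc ∫ a, φ a ∂Q
      ≤ ∫ a, (k / 4 * (explorationDensity k f b a * φ a ^ 2) + 1 / k + max 0 (f a - f b)) ∂Q :=
        integral_mono (integrable_of_mem_smoothComparators hQ (hφ.integrable one_le_two))
          (((hweightedQ.const_mul _).add (integrable_const _)).add hgap) fun a =>
          le_mul_explorationDensity_mul_sq hk f b a (φ a)
    _ = k / 4 * ∫ a, explorationDensity k f b a * φ a ^ 2 ∂Q + 1 / k +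
          ∫ a, max 0 (f a - f b) ∂Q := by
        rw [integral_add (by fun_prop) hgap, integral_add (by fun_prop) (integrable_const _),
          integral_const_mul, integral_const, probReal_univ, one_smul]
    _ ≤ k / 4 * (1 / h * ∫ a, φ a ^ 2 ∂(contAL q h γ μ f b)) + 1 / k +
          ∫ a, max 0 (f a - f b) ∂Q := by gcongr
    _ = theta q * γ * ∫ a, φ a ^ 2 ∂(contAL q h γ μ f b) + 1 / k +
          ∫ a, max 0 (f a - f b) ∂Q := by rw [hscale]

lemma integral_sub_integral_contAL_le (hκ : 0 < 4 * theta q * γ) (hh : 0 < h)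
    (hfm : Measurable f) (hf : Integrable f μ) (b : A) {Q : Measure A}
    (hQ : Q ∈ smoothComparators μ h) {φ : A → ℝ} (hφm : Measurable φ) (hφ : MemLp φ 2 μ) :
    ∫ a, φ a ∂Q - ∫ a, φ a ∂(contAL q h γ μ f b) ≤
      theta q * γ * ∫ a, φ a ^ 2 ∂(contAL q h γ μ f b) + 1 / (4 * theta q * γ * h)
        + ∫ a, max 0 (f a - f b) ∂Q := by
  have := hQ.1
  set κ := 4 * theta q * γ with hκ_def
  have hk : 0 < κ * h := mul_pos hκ hh
  set p := contAL q h γ μ f b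
  have : IsProbabilityMeasure p := isProbabilityMeasure_contAL hk.le f b
  have hφ₁ := hφ.integrable one_le_two
  have hφQ := integrable_of_mem_smoothComparators hQ hφ₁
  have hφp : Integrable φ p := integrable_contAL hk.le hφm hφ₁ f b
  have hsqp : Integrable (fun a => φ a ^ 2) p :=
    integrable_contAL hk.le (by fun_prop) hφ.integrable_sq f b
  -- Shifting `φ` by `2 / κ` before squaring produces the linear term `∫ a, φ a ∂p`.
  have hshift := integral_le_theta_mul_integral_sq_contAL hκ hh hfm hf b hQ
    (φ := fun a => φ a + 2 / κ) (by fun_prop) (hφ.add (memLp_const _))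
  have hexpand (a : A) : (φ a + 2 / κ) ^ 2 = φ a ^ 2 + 4 / κ * φ a + (2 / κ) ^ 2 := by ring
  have hsq : ∫ a, (φ a + 2 / κ) ^ 2 ∂p =
      ∫ a, φ a ^ 2 ∂p + 4 / κ * ∫ a, φ a ∂p + (2 / κ) ^ 2 := by
    simp only [hexpand]
    rw [integral_add (by fun_prop) (integrable_const _), integral_add hsqp (by fun_prop),
      integral_const_mul, integral_const, probReal_univ, one_smul]
  rw [integral_add hφQ (integrable_const _), integral_const, probReal_univ, one_smul, hsq] at hshift
  have hscale : theta q * γ = κ / 4 := by rw [hκ_def]; ring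
  have hcomplete : κ / 4 * (∫ a, φ a ^ 2 ∂p + 4 / κ * ∫ a, φ a ∂p + (2 / κ) ^ 2) =
      κ / 4 * ∫ a, φ a ^ 2 ∂p + ∫ a, φ a ∂p + 1 / κ := by field_simp; ring
  have htwo : 2 / κ = 1 / κ + 1 / κ := by ring
  have hinv : 0 < 1 / κ := one_div_pos.2 hκ
  rw [hscale, hcomplete] at hshift
  rw [hscale]
  linarith

lemma integral_contAL_le_integral_smoothComparator (hκ : 0 < 4 * theta q * γ) (hh : 0 < h)
    {g : A → ℝ} (hfm : Measurable f) (hgm : Measurable g) (hf : MemLp f 2 μ) (hg : MemLp g 2 μ)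
    (b : A) {Q : Measure A} (hQ : Q ∈ smoothComparators μ h) :
    ∫ a, g a ∂(contAL q h γ μ f b) ≤ ∫ a, g a ∂Q
      + theta q * γ * ∫ a, (f a - g a) ^ 2 ∂(contAL q h γ μ f b)
      + 2 / (4 * theta q * γ * h) + 1 / h * ∫ a, max 0 (f b - f a) ∂μ := by
  have := hQ.1
  have hk : 0 < 4 * theta q * γ * h := mul_pos hκ hh
  have hf₁ := hf.integrable one_le_two
  have hg₁ := hg.integrable one_le_two
  have hfQ := integrable_of_mem_smoothComparators hQ hf₁
  have hhingeQ := integrable_of_mem_smoothComparators hQ (integrable_hinge hf₁ (f b))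
  have herror := integral_sub_integral_contAL_le hκ hh hfm hf₁ b hQ (hfm.sub hgm) (hf.sub hg)
  simp only [Pi.sub_apply] at herror
  rw [integral_sub hfQ (integrable_of_mem_smoothComparators hQ hg₁),
    integral_sub (integrable_contAL hk.le hfm hf₁ f b) (integrable_contAL hk.le hgm hg₁ f b)]
    at herror
  have hgap : ∫ a, max 0 (f a - f b) ∂Q = ∫ a, f a ∂Q - f b + ∫ a, max 0 (f b - f a) ∂Q := by
    have hpointwise (a : A) : max 0 (f a - f b) = f a - f b + max 0 (f b - f a) := by grind
    simp only [hpointwise]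
    rw [integral_add (by fun_prop) hhingeQ, integral_sub hfQ (integrable_const _),
      integral_const, probReal_univ, one_smul]
  have hhinge := integral_le_of_mem_smoothComparators hh hQ (fun a => le_max_left 0 (f b - f a))
    (integrable_hinge hf₁ (f b))
  have hgreedy := integral_contAL_le hk hfm hf₁ b
  have htwo : 2 / (4 * theta q * γ * h) =
    1 / (4 * theta q * γ * h) + 1 / (4 * theta q * γ * h) := by ring
  linarith

lemma integral_comp_contAL_le_integral_smoothComparator
    (hκ : 0 < 4 * theta q * γ) (hh : 0 < h) {g : A → ℝ} (hfm : Measurable f) (hgm : Measurable g)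
    {l u δ : ℝ} (hf : ∀ a, f a ∈ Icc l u) (hg : ∀ a, g a ∈ Icc l u) {K : Kernel A A}
    (hK : ∀ b, K b = contAL q h γ μ f b) {Z : Type*} [MeasurableSpace Z] {κ : Kernel Z A}
    [IsMarkovKernel κ] {z : Z} (hδ : ∫ b, ∫ a, max 0 (f b - f a) ∂μ ∂(κ z) ≤ δ) {Q : Measure A}
    (hQ : Q ∈ smoothComparators μ h) :
    ∫ a, g a ∂((K ∘ₖ κ) z) ≤ ∫ a, g a ∂Q + theta q * γ * ∫ a, (f a - g a) ^ 2 ∂((K ∘ₖ κ) z)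
      + 2 / (4 * theta q * γ * h) + 1 / h * δ := by
  have hKmarkov : IsMarkovKernel K :=
    ⟨fun b => by rw [hK b]; exact isProbabilityMeasure_contAL (mul_pos hκ hh).le f b⟩
  have hL2 (ν : Measure A) [IsFiniteMeasure ν] {φ : A → ℝ} (hφm : Measurable φ)
      (hφ : ∀ a, φ a ∈ Icc l u) : MemLp φ 2 ν :=
    memLp_of_bounded (ae_of_all _ hφ) hφm.aestronglyMeasurable 2
  have hgi : Integrable g ((K ∘ₖ κ) z) := (hL2 _ hgm hg).integrable one_le_two
  have hsq : Integrable (fun a => (f a - g a) ^ 2) ((K ∘ₖ κ) z) :=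
    ((hL2 _ hfm hf).sub (hL2 _ hgm hg)).integrable_sq
  have hgap : Integrable (fun b => ∫ a, max 0 (f b - f a) ∂μ) (κ z) :=
    Integrable.integral_prod_left (f := fun p : A × A => max 0 (f p.1 - f p.2))
      ((integrable_zero _ _ _).sup
        ((((hL2 (κ z) hfm hf).integrable one_le_two).comp_fst μ).sub
          (((hL2 μ hfm hf).integrable one_le_two).comp_snd (κ z))))
  have hsqK := hsq.integral_comp
  have hpointwise (b : A) : ∫ a, g a ∂(K b) ≤ ∫ a, g a ∂Q
      + theta q * γ * ∫ a, (f a - g a) ^ 2 ∂(K b) + 2 / (4 * theta q * γ * h)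
      + 1 / h * ∫ a, max 0 (f b - f a) ∂μ := by
    rw [hK b]
    exact integral_contAL_le_integral_smoothComparator hκ hh hfm hgm (hL2 μ hfm hf)
      (hL2 μ hgm hg) b hQ
  calc ∫ a, g a ∂((K ∘ₖ κ) z) = ∫ b, ∫ a, g a ∂(K b) ∂(κ z) := Kernel.integral_comp hgi
    _ ≤ ∫ b, (∫ a, g a ∂Q + theta q * γ * ∫ a, (f a - g a) ^ 2 ∂(K b)
        + 2 / (4 * theta q * γ * h) + 1 / h * ∫ a, max 0 (f b - f a) ∂μ) ∂(κ z) :=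
      integral_mono hgi.integral_comp (by fun_prop) hpointwise
    _ = ∫ a, g a ∂Q + theta q * γ * ∫ a, (f a - g a) ^ 2 ∂((K ∘ₖ κ) z)
        + 2 / (4 * theta q * γ * h) + 1 / h * ∫ b, ∫ a, max 0 (f b - f a) ∂μ ∂(κ z) := by
      rw [integral_add (by fun_prop) (by fun_prop), integral_add (by fun_prop) (by fun_prop),
        integral_add (by fun_prop) (by fun_prop), integral_const_mul, integral_const_mul,
        ← Kernel.integral_comp hsq]
      simp only [integral_const, probReal_univ, one_smul]
    _ ≤ _ := by gcongr

end Exploration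

/-! ### The interaction -/

section Interaction

section Round

variable {X A S : Type*} {T : ℕ}

/-- The history before round `t` together with the outcome of round `t`, cut out of a longer
history. -/
def History.round (t : Fin T) (H : History X A S T) : History X A S t × (X × S × A) :=
  (fun i => H (Fin.castLE t.isLt.le i), H t)

lemma round_last_snoc (p : History X A S T × (X × S × A)) :
    History.round (Fin.last T) (Fin.snoc (α := fun _ => X × S × A) p.1 p.2) = p :=
  Prod.ext (funext fun i => Fin.snoc_castSucc (α := fun _ => X × S × A) p.2 p.1 i)
    (Fin.snoc_last (α := fun _ => X × S × A) p.2 p.1)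

lemma round_castSucc_snoc (t : Fin T) (p : History X A S T × (X × S × A)) :
    History.round t.castSucc (Fin.snoc (α := fun _ => X × S × A) p.1 p.2) = p.1.round t :=
  Prod.ext
    (funext fun i => Fin.snoc_castSucc (α := fun _ => X × S × A) p.2 p.1 (Fin.castLE t.isLt.le i))
    (Fin.snoc_castSucc (α := fun _ => X × S × A) p.2 p.1 t)

end Round

variable {X A S Φ : Type*} [MeasurableSpace X] [MeasurableSpace A] [MeasurableSpace S]
  [MeasurableSpace Φ] {E : Environment X A S} {F : FunctionClass Φ X A}
  {O : RegressionOracle Φ X A} {P : OptimizationOracle Φ X A} {μ : Measure A} {q h γ : ℝ}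
  {t T : ℕ}

@[fun_prop]
lemma FunctionClass.measurable_eval_comp (F : FunctionClass Φ X A) {Y : Type*} [MeasurableSpace Y]
    {φ : Y → Φ} {x : Y → X} {a : Y → A} (hφ : Measurable φ) (hx : Measurable x)
    (ha : Measurable a) : Measurable fun y => F.eval (φ y) (x y) (a y) :=
  F.measurable_eval.comp ((hφ.prodMk hx).prodMk ha)

@[fun_prop]
lemma Environment.measurable_loss_comp (E : Environment X A S) {Y : Type*} [MeasurableSpace Y]
    {s : Y → S} {a : Y → A} (hs : Measurable s) (ha : Measurable a) :
    Measurable fun y => E.loss (s y) (a y) :=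
  E.measurable_loss.comp (hs.prodMk ha)

section Law

lemma measurable_snoc (t : ℕ) :
    Measurable fun p : History X A S t × (X × S × A) =>
      (Fin.snoc (α := fun _ => X × S × A) p.1 p.2 : History X A S (t + 1)) := by
  refine measurable_pi_lambda _ fun i => ?_
  induction i using Fin.lastCases with
  | last => simpa only [Fin.snoc_last] using measurable_snd
  | cast i =>
    simp only [Fin.snoc_castSucc]
    exact (measurable_pi_apply i).comp measurable_fst

lemma measurable_round (t : Fin T) : Measurable (History.round (X := X) (A := A) (S := S) t) :=
  (measurable_pi_lambda _ fun _ => measurable_pi_apply _).prodMk (measurable_pi_apply _)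

variable [SFinite μ]

instance [∀ t, IsMarkovKernel (actionLaw E F O P μ q h γ t)] (t : ℕ) :
    IsMarkovKernel (roundLaw E F O P μ q h γ t) := by
  unfold roundLaw; infer_instance

instance [∀ t, IsMarkovKernel (actionLaw E F O P μ q h γ t)] (t : ℕ) :
    IsProbabilityMeasure (historyLaw E F O P μ q h γ t) := by
  induction t with
  | zero => unfold historyLaw; infer_instance
  | succ t ih =>
    unfold historyLaw
    exact Measure.isProbabilityMeasure_map (measurable_snoc t).aemeasurable

variable [∀ t, IsMarkovKernel (actionLaw E F O P μ q h γ t)]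

lemma map_round_historyLaw (t : Fin T) :
    (historyLaw E F O P μ q h γ T).map (History.round t) =
      historyLaw E F O P μ q h γ t ⊗ₘ roundLaw E F O P μ q h γ t := by
  induction T with
  | zero => exact t.elim0
  | succ T ih =>
    rw [historyLaw, Measure.map_map (measurable_round t) (measurable_snoc T)]
    induction t using Fin.lastCases with
    | last =>
      simp only [Function.comp_def, round_last_snoc]
      exact Measure.map_id
    | cast t =>
      simp only [Function.comp_def, round_castSucc_snoc]
      calc _ = (historyLaw E F O P μ q h γ T ⊗ₘ roundLaw E F O P μ q h γ T).fst.map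
            (History.round t) := (Measure.map_map (measurable_round t) measurable_fst).symm
        _ = _ := by rw [Measure.fst_compProd]; exact ih t

lemma integral_round_nonneg (t : Fin T) {G : History X A S t × (X × S × A) → ℝ}
    (hG : Integrable G (historyLaw E F O P μ q h γ t ⊗ₘ roundLaw E F O P μ q h γ t))
    (hcond : ∀ H x, 0 ≤
      ∫ y, G (H, (x, y)) ∂((E.lossLaw t (H, x)).prod (actionLaw E F O P μ q h γ t (H, x)))) :
    0 ≤ ∫ H, G (H.round t) ∂(historyLaw E F O P μ q h γ T) := by
  rw [← integral_map (measurable_round t).aemeasurable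
      (by rw [map_round_historyLaw]; exact hG.aestronglyMeasurable),
    map_round_historyLaw, Measure.integral_compProd hG]
  have hround := ((Measure.integrable_compProd_iff hG.aestronglyMeasurable).1 hG).1
  refine integral_nonneg_of_ae (hround.mono fun H hH => ?_)
  rw [roundLaw] at hH ⊢
  dsimp only [Pi.zero_apply]
  rw [ProbabilityTheory.integral_compProd hH]
  refine integral_nonneg fun x => ?_
  rw [Kernel.prod_apply]
  exact hcond H x

end Law

section Prediction

/-- The prediction of the regression oracle for the loss of the action `a` in round `t`, the
function `f̂_t` of the algorithm. -/
noncomputable def predicted (E : Environment X A S) (F : FunctionClass Φ X A)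
    (O : RegressionOracle Φ X A) (t : ℕ) (H : History X A S t) (x : X) (a : A) : ℝ :=
  F.eval (O.predict t (E.observe H) x) x a

/-- The expectile loss of the regression oracle in round `t` minus that of the benchmark `φ`,
both for the realized loss of the realized action. -/
noncomputable def excessLoss (E : Environment X A S) (F : FunctionClass Φ X A)
    (O : RegressionOracle Φ X A) (φ : Φ) (q : ℝ) (t : ℕ) (p : History X A S t × (X × S × A)) : ℝ :=
  expectileLoss q (E.loss p.2.2.1 p.2.2.2) (predicted E F O t p.1 p.2.1 p.2.2.2)
    - expectileLoss q (E.loss p.2.2.1 p.2.2.2) (F.eval φ p.2.1 p.2.2.2)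

@[fun_prop]
lemma measurable_predicted {Y : Type*} [MeasurableSpace Y] {H : Y → History X A S t} {x : Y → X}
    {a : Y → A} (hH : Measurable H) (hx : Measurable x) (ha : Measurable a) :
    Measurable fun y => predicted E F O t (H y) (x y) (a y) :=
  F.measurable_eval_comp
    ((O.measurable_predict t).comp (((E.measurable_observe t).comp hH).prodMk hx)) hx ha

@[fun_prop]
lemma measurable_excessLoss (φ : Φ) : Measurable (excessLoss E F O φ q t) := by
  unfold excessLoss; fun_prop

lemma predicted_mem_Icc (H : History X A S t) (x : X) (a : A) :
    predicted E F O t H x a ∈ Icc (0 : ℝ) 1 :=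
  F.eval_mem _ _ _

lemma excessLoss_mem_Icc (hq : q ∈ Icc (0 : ℝ) 1) (φ : Φ) (p : History X A S t × (X × S × A)) :
    excessLoss E F O φ q t p ∈ Icc (-1 : ℝ) 1 := by
  have hpred := expectileLoss_mem_Icc hq (E.loss_mem p.2.2.1 p.2.2.2)
    (predicted_mem_Icc (E := E) (F := F) (O := O) p.1 p.2.1 p.2.2.2)
  have hφ := expectileLoss_mem_Icc hq (E.loss_mem p.2.2.1 p.2.2.2) (F.eval_mem φ p.2.1 p.2.2.2)
  exact ⟨by unfold excessLoss; linarith [hpred.1, hφ.2],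
    by unfold excessLoss; linarith [hpred.2, hφ.1]⟩

lemma integrable_excessLoss (hq : q ∈ Icc (0 : ℝ) 1) (φ : Φ) {Ω : Type*} [MeasurableSpace Ω]
    {ν : Measure Ω} [IsFiniteMeasure ν] {Y : Ω → History X A S t × (X × S × A)}
    (hY : Measurable Y) : Integrable (fun ω => excessLoss E F O φ q t (Y ω)) ν :=
  .of_mem_Icc (-1) 1 (by fun_prop) (ae_of_all _ fun _ => excessLoss_mem_Icc hq φ _)

lemma sum_excessLoss_le {𝓕 : Set Φ} {R : ℝ} (hO : O.HasRegretBound F 𝓕 q T R) {φ : Φ}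
    (hφ : φ ∈ 𝓕) (H : History X A S T) :
    ∑ t : Fin T, excessLoss E F O φ q t (H.round t) ≤ R :=
  hO (E.observe H) (fun _ => E.loss_mem _ _) φ hφ

lemma theta_mul_sq_le_integral_excessLoss (hq : q ∈ Icc (0 : ℝ) 1) {φ : Φ} {H : History X A S t}
    {x : X} {a : A} (hφ : F.eval φ x a = EVaR q (E.lossDist t H x a)) :
    theta q * (predicted E F O t H x a - F.eval φ x a) ^ 2 ≤
      ∫ s, excessLoss E F O φ q t (H, (x, (s, a))) ∂(E.lossLaw t (H, x)) := by
  have hloss : Measurable fun s => E.loss s a := by fun_prop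
  have : IsProbabilityMeasure (E.lossDist t H x a) :=
    Measure.isProbabilityMeasure_map hloss.aemeasurable
  have hmem : ∀ᵐ v ∂(E.lossDist t H x a), v ∈ Icc (0 : ℝ) 1 :=
    (ae_map_iff hloss.aemeasurable measurableSet_Icc).2 (ae_of_all _ fun s => E.loss_mem s a)
  have hle := theta_mul_sq_sub_EVaR_le hq hmem
    (predicted_mem_Icc (E := E) (F := F) (O := O) H x a)
  rw [← hφ] at hle
  exact hle.trans_eq (integral_map hloss.aemeasurable (by fun_prop))

lemma theta_mul_integral_sq_le_integral_excessLoss (hq : q ∈ Icc (0 : ℝ) 1) {φ : Φ}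
    {H : History X A S t} {x : X} (hφ : ∀ a, F.eval φ x a = EVaR q (E.lossDist t H x a))
    (π : Measure A) [IsProbabilityMeasure π] :
    theta q * ∫ a, (predicted E F O t H x a - F.eval φ x a) ^ 2 ∂π ≤
      ∫ y, excessLoss E F O φ q t (H, (x, y)) ∂((E.lossLaw t (H, x)).prod π) := by
  have hexcess : Integrable (fun y => excessLoss E F O φ q t (H, (x, y)))
      ((E.lossLaw t (H, x)).prod π) :=
    integrable_excessLoss hq φ (by fun_prop)
  have hsq : Integrable (fun a => (predicted E F O t H x a - F.eval φ x a) ^ 2) π :=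
    ((memLp_of_bounded (ae_of_all _ (predicted_mem_Icc H x)) (by fun_prop) 2).sub
      (memLp_of_bounded (ae_of_all _ (F.eval_mem φ x)) (by fun_prop) 2)).integrable_sq
  rw [integral_prod_symm _ hexcess, ← integral_const_mul]
  exact integral_mono (hsq.const_mul _) hexcess.integral_prod_right fun a =>
    theta_mul_sq_le_integral_excessLoss hq (hφ a)

end Prediction

end Interaction

lemma exploration_cost_add_regression_cost_le {θ h T R K : ℝ} (hθ : 0 < θ) (hh : 0 < h)
    (hT : 0 < T) (hK : 0 < K) (hR : θ * R ≤ K) :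
    T * (3 / (4 * θ * √(3 * T / (4 * h * K)) * h)) + √(3 * T / (4 * h * K)) * R ≤
      1 / θ * √(3 * T / h * K) := by
  set γ := √(3 * T / (4 * h * K)) with hγ_def
  have hγ : 0 < γ := by positivity
  have hT_eq : 3 * T = γ ^ 2 * (4 * h * K) := by
    rw [hγ_def, Real.sq_sqrt (by positivity), div_mul_cancel₀ _ (by positivity)]
  have hroot : √(3 * T / h * K) = 2 * K * γ := by
    rw [hT_eq, Real.sqrt_eq_iff_eq_sq (by positivity) (by positivity)]
    field_simp
    ring
  have hexploration : T * (3 / (4 * θ * γ * h)) = K * γ / θ := by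
    rw [← mul_div_assoc, mul_comm T, hT_eq]
    field_simp
  have hregression : γ * R ≤ K * γ / θ := by
    rw [le_div_iff₀ hθ]
    nlinarith
  rw [hroot, hexploration]
  linarith [show 1 / θ * (2 * K * γ) = K * γ / θ + K * γ / θ by ring]

section Regret

variable {X A S Φ : Type*} [MeasurableSpace X] [MeasurableSpace A] [MeasurableSpace S]
  [MeasurableSpace Φ] {E : Environment X A S} {F : FunctionClass Φ X A}
  {O : RegressionOracle Φ X A} {P : OptimizationOracle Φ X A} {μ : Measure A}
  [IsProbabilityMeasure μ] {q h γ : ℝ} {t T : ℕ} {φ : Φ}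

lemma actionLaw_apply (H : History X A S t) (x : X) :
    actionLaw E F O P μ q h γ t (H, x) =
      ((contALKernel q h γ μ F).comap (Prod.mk (O.predict t (E.observe H) x, x))
        measurable_prodMk_left ∘ₖ P.choose (1 / (4 * theta q * γ)))
        (O.predict t (E.observe H) x, x) := by
  rw [actionLaw, Kernel.comap_apply, Kernel.comp_apply, Kernel.comp_apply, Kernel.prod_apply,
    Kernel.id_apply, Measure.dirac_prod, Measure.bind, Measure.bind, Measure.map_map]
  · rfl
  · exact Kernel.measurable _
  · exact measurable_prodMk_left

lemma isMarkovKernel_actionLaw (hk : 0 ≤ 4 * theta q * γ * h) (t : ℕ) :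
    IsMarkovKernel (actionLaw E F O P μ q h γ t) := by
  have : IsMarkovKernel (contALKernel q h γ μ F) :=
    ⟨fun p => isProbabilityMeasure_contAL hk (F.eval p.1.1 p.1.2) p.2⟩
  unfold actionLaw
  infer_instance

lemma roundRegret_eq (hφ : ∀ (H : History X A S t) x a, F.eval φ x a = EVaR q (E.lossDist t H x a))
    (H : History X A S t) (x : X) :
    roundRegret E F O P μ q h γ t H x =
      ∫ a, F.eval φ x a ∂(actionLaw E F O P μ q h γ t (H, x))
        - ⨅ Q : smoothComparators μ h, ∫ a, F.eval φ x a ∂(Q : Measure A) := by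
  simp only [roundRegret, ← hφ H x]

lemma roundRegret_le (hP : P.IsAccurate F μ) (hκ : 0 < 4 * theta q * γ) (hh0 : 0 < h)
    (hh1 : h ≤ 1)
    (hφ : ∀ (H : History X A S t) x a, F.eval φ x a = EVaR q (E.lossDist t H x a))
    (H : History X A S t) (x : X) :
    roundRegret E F O P μ q h γ t H x ≤ theta q * γ *
      ∫ a, (predicted E F O t H x a - F.eval φ x a) ^ 2 ∂(actionLaw E F O P μ q h γ t (H, x))
        + 3 / (4 * theta q * γ * h) := by
  have : Nonempty (smoothComparators μ h) := ⟨⟨μ, self_mem_smoothComparators hh0 hh1⟩⟩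
  rw [roundRegret_eq hφ, sub_le_comm, actionLaw_apply]
  refine le_ciInf fun Q => ?_
  have hcomp := integral_comp_contAL_le_integral_smoothComparator (f := predicted E F O t H x)
    (K := (contALKernel q h γ μ F).comap (Prod.mk (O.predict t (E.observe H) x, x))
      measurable_prodMk_left)
    hκ hh0 (by fun_prop) (by fun_prop) (predicted_mem_Icc H x) (F.eval_mem φ x) (fun _ => rfl)
    (hP (1 / (4 * theta q * γ)) (one_div_pos.2 hκ) (O.predict t (E.observe H) x) x) Q.2
  have hthree : 3 / (4 * theta q * γ * h) =
    2 / (4 * theta q * γ * h) + 1 / h * (1 / (4 * theta q * γ)) := by field_simp; norm_num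
  linarith

section Markov

variable [∀ t, IsMarkovKernel (actionLaw E F O P μ q h γ t)]

lemma roundRegret_mem_Icc (hh0 : 0 < h) (hh1 : h ≤ 1)
    (hφ : ∀ (H : History X A S t) x a, F.eval φ x a = EVaR q (E.lossDist t H x a))
    (H : History X A S t) (x : X) :
    roundRegret E F O P μ q h γ t H x ∈ Icc (-1 : ℝ) 1 := by
  have hlearner := integral_mem_Icc (ν := actionLaw E F O P μ q h γ t (H, x))
    (f := fun a => F.eval φ x a) (by fun_prop) (ae_of_all _ (F.eval_mem φ x))
  have hbest := iInf_smoothComparators_mem_Icc (μ := μ) hh0 hh1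
    (f := fun a => F.eval φ x a) (by fun_prop) (ae_of_all _ (F.eval_mem φ x))
  rw [roundRegret_eq hφ]
  exact ⟨by linarith [hlearner.1, hbest.2], by linarith [hlearner.2, hbest.1]⟩

lemma measurable_roundRegret (hh0 : 0 < h) (hh1 : h ≤ 1)
    (hφ : ∀ (H : History X A S t) x a, F.eval φ x a = EVaR q (E.lossDist t H x a)) :
    Measurable fun p : History X A S t × X => roundRegret E F O P μ q h γ t p.1 p.2 := by
  simp only [roundRegret_eq hφ]
  refine .sub ?_ ?_
  · exact (StronglyMeasurable.integral_kernel_prod_right'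
      (f := fun p : (History X A S t × X) × A => F.eval φ p.1.2 p.2)
      (by fun_prop)).measurable
  · exact (measurable_iInf_smoothComparators hh0 hh1 (by fun_prop)
      fun x => ae_of_all _ (F.eval_mem φ x)).comp measurable_snd

lemma integrable_roundRegret (hh0 : 0 < h) (hh1 : h ≤ 1)
    (hφ : ∀ (H : History X A S t) x a, F.eval φ x a = EVaR q (E.lossDist t H x a))
    {Ω : Type*} [MeasurableSpace Ω] {ν : Measure Ω} [IsFiniteMeasure ν]
    {Y : Ω → History X A S t} {ξ : Ω → X} (hY : Measurable Y) (hξ : Measurable ξ) :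
    Integrable (fun ω => roundRegret E F O P μ q h γ t (Y ω) (ξ ω)) ν :=
  .of_mem_Icc (-1) 1
    ((measurable_roundRegret hh0 hh1 hφ).comp (hY.prodMk hξ)).aemeasurable
    (ae_of_all _ fun _ => roundRegret_mem_Icc hh0 hh1 hφ _ _)

lemma integral_excessLoss_nonneg (hq : q ∈ Icc (0 : ℝ) 1) (t : Fin T)
    (hφ : ∀ (H : History X A S t) x a, F.eval φ x a = EVaR q (E.lossDist t H x a)) :
    0 ≤ ∫ H, excessLoss E F O φ q t (H.round t) ∂(historyLaw E F O P μ q h γ T) :=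
  integral_round_nonneg t (integrable_excessLoss hq φ measurable_id) fun H x =>
    (mul_nonneg (le_min hq.1 (sub_nonneg.2 hq.2)) (integral_nonneg fun _ => sq_nonneg _)).trans
      (theta_mul_integral_sq_le_integral_excessLoss hq (hφ H x) _)

lemma sum_integral_excessLoss_le (hq : q ∈ Icc (0 : ℝ) 1) {𝓕 : Set Φ} {R : ℝ}
    (hO : O.HasRegretBound F 𝓕 q T R) (hφ : φ ∈ 𝓕) :
    ∑ t : Fin T, ∫ H, excessLoss E F O φ q t (H.round t) ∂(historyLaw E F O P μ q h γ T) ≤ R := by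
  rw [← integral_finsetSum _ fun t _ => integrable_excessLoss hq φ (measurable_round t)]
  simpa only [integral_const, probReal_univ, one_smul] using
    integral_mono
      (integrable_finsetSum _ fun t _ => integrable_excessLoss hq φ (measurable_round t))
      (integrable_const (μ := historyLaw E F O P μ q h γ T) R) (sum_excessLoss_le hO hφ)

lemma roundRegret_le_add_integral_excessLoss (hP : P.IsAccurate F μ) (hq0 : 0 < q) (hq1 : q < 1)
    (hγ : 0 < γ) (hh0 : 0 < h) (hh1 : h ≤ 1)
    (hφ : ∀ (H : History X A S t) x a, F.eval φ x a = EVaR q (E.lossDist t H x a))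
    (H : History X A S t) (x : X) :
    roundRegret E F O P μ q h γ t H x ≤ 3 / (4 * theta q * γ * h) +
      γ * ∫ y, excessLoss E F O φ q t (H, (x, y))
        ∂((E.lossLaw t (H, x)).prod (actionLaw E F O P μ q h γ t (H, x))) := by
  have hround := roundRegret_le (O := O) hP
    (mul_pos (mul_pos four_pos (theta_pos hq0 hq1)) hγ) hh0 hh1 hφ H x
  have hsq := mul_le_mul_of_nonneg_left (theta_mul_integral_sq_le_integral_excessLoss (O := O)
    ⟨hq0.le, hq1.le⟩ (hφ H x) (actionLaw E F O P μ q h γ t (H, x))) hγ.le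
  linarith

lemma integral_roundRegret_le (hP : P.IsAccurate F μ) (hq0 : 0 < q) (hq1 : q < 1) (hγ : 0 < γ)
    (hh0 : 0 < h) (hh1 : h ≤ 1) (t : Fin T)
    (hφ : ∀ (H : History X A S t) x a, F.eval φ x a = EVaR q (E.lossDist t H x a)) :
    ∫ H, roundRegret E F O P μ q h γ t (H.round t).1 (H.round t).2.1
        ∂(historyLaw E F O P μ q h γ T) ≤
      3 / (4 * theta q * γ * h) + γ * ∫ H, excessLoss E F O φ q t (H.round t)
        ∂(historyLaw E F O P μ q h γ T) := by
  have hq : q ∈ Icc (0 : ℝ) 1 := ⟨hq0.le, hq1.le⟩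
  have hcond (H : History X A S t) (x : X) :
      0 ≤ ∫ y, (3 / (4 * theta q * γ * h) + γ * excessLoss E F O φ q t (H, (x, y))
        - roundRegret E F O P μ q h γ t H x)
        ∂((E.lossLaw t (H, x)).prod (actionLaw E F O P μ q h γ t (H, x))) := by
    have hexcess := (integrable_excessLoss (E := E) (F := F) (O := O)
      (ν := (E.lossLaw t (H, x)).prod (actionLaw E F O P μ q h γ t (H, x))) hq φ
      (Y := fun y => (H, (x, y))) (by fun_prop)).const_mul γ
    rw [integral_sub (by fun_prop) (integrable_const _), integral_add (by fun_prop) hexcess,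
      integral_const_mul]
    simp only [integral_const, probReal_univ, one_smul, sub_nonneg]
    exact roundRegret_le_add_integral_excessLoss hP hq0 hq1 hγ hh0 hh1 hφ H x
  have hexcess := (integrable_excessLoss (E := E) (F := F) (O := O)
    (ν := historyLaw E F O P μ q h γ T) hq φ (measurable_round t)).const_mul γ
  have hregret := integrable_roundRegret (E := E) (F := F) (O := O) (P := P) (μ := μ) (γ := γ)
    (ν := historyLaw E F O P μ q h γ T) hh0 hh1 hφ (measurable_round t).fst
    (measurable_round t).snd.fst
  have hslack := integral_round_nonneg t (((integrable_const _).add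
    ((integrable_excessLoss hq φ measurable_id).const_mul γ)).sub
    (integrable_roundRegret hh0 hh1 hφ measurable_fst measurable_snd.fst)) hcond
  simp only [Pi.add_apply, Pi.sub_apply, id_eq] at hslack
  rw [integral_sub (by fun_prop) hregret, integral_add (by fun_prop) hexcess,
    integral_const_mul, integral_const, probReal_univ, one_smul, sub_nonneg] at hslack
  exact hslack

end Markov

lemma regretBound_nonneg (P : OptimizationOracle Φ X A) (μ : Measure A) [IsProbabilityMeasure μ]
    {𝓕 : Set Φ} {R : ℝ} (hq : q ∈ Icc (0 : ℝ) 1) (hreal : E.Realizable F 𝓕 q T)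
    (hO : O.HasRegretBound F 𝓕 q T R) : 0 ≤ R := by
  obtain ⟨φ, hφ, hφE⟩ := hreal
  have := isMarkovKernel_actionLaw (E := E) (F := F) (O := O) (P := P) (μ := μ) (q := q)
    (γ := 0) (h := 1) (by simp)
  exact (Finset.sum_nonneg fun (t : Fin T) _ => integral_excessLoss_nonneg (P := P) (μ := μ)
    (h := 1) (γ := 0) hq t (hφE t t.isLt)).trans (sum_integral_excessLoss_le hq hO hφ)

lemma expectedRegretLE {𝓕 : Set Φ} {R : ℝ} (hP : P.IsAccurate F μ) (hq0 : 0 < q) (hq1 : q < 1)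
    (hγ : 0 < γ) (hh0 : 0 < h) (hh1 : h ≤ 1) (hreal : E.Realizable F 𝓕 q T)
    (hO : O.HasRegretBound F 𝓕 q T R) :
    ExpectedRegretLE E F O P μ q h γ T (T * (3 / (4 * theta q * γ * h)) + γ * R) := by
  obtain ⟨φ, hφ, hφE⟩ := hreal
  have hθ := theta_pos hq0 hq1
  have := isMarkovKernel_actionLaw (E := E) (F := F) (O := O) (P := P) (μ := μ)
    (by positivity : 0 ≤ 4 * theta q * γ * h)
  have hround (t : Fin T) : Integrable (fun H : History X A S T =>
      roundRegret E F O P μ q h γ t (H.round t).1 (H.round t).2.1)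
      (historyLaw E F O P μ q h γ T) :=
    integrable_roundRegret hh0 hh1 (hφE t t.isLt) (measurable_round t).fst
      (measurable_round t).snd.fst
  refine ⟨integrable_finsetSum _ fun t _ => hround t, ?_⟩
  calc ∫ H, regret E F O P μ q h γ T H ∂(historyLaw E F O P μ q h γ T)
      = ∑ t : Fin T, ∫ H, roundRegret E F O P μ q h γ t (H.round t).1 (H.round t).2.1
        ∂(historyLaw E F O P μ q h γ T) := integral_finsetSum _ fun t _ => hround t
    _ ≤ ∑ t : Fin T, (3 / (4 * theta q * γ * h) + γ * ∫ H, excessLoss E F O φ q t (H.round t)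
        ∂(historyLaw E F O P μ q h γ T)) :=
      Finset.sum_le_sum fun t _ =>
        integral_roundRegret_le hP hq0 hq1 hγ hh0 hh1 t (hφE t t.isLt)
    _ = T * (3 / (4 * theta q * γ * h)) + γ * ∑ t : Fin T,
        ∫ H, excessLoss E F O φ q t (H.round t) ∂(historyLaw E F O P μ q h γ T) := by
      rw [Finset.sum_add_distrib, ← Finset.mul_sum, Finset.sum_const, Finset.card_univ,
        Fintype.card_fin, nsmul_eq_mul]
    _ ≤ _ := by
      gcongr
      exact sum_integral_excessLoss_le ⟨hq0.le, hq1.le⟩ hO hφ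

lemma expectedRegretLE_sqrt {𝓕 : Set Φ} {R K : ℝ} (hP : P.IsAccurate F μ) (hq0 : 0 < q)
    (hq1 : q < 1) (hh0 : 0 < h) (hh1 : h ≤ 1) (hT : 1 ≤ T) (hreal : E.Realizable F 𝓕 q T)
    (hO : O.HasRegretBound F 𝓕 q T R) (hK : 0 < K) (hR : theta q * R ≤ K) :
    ExpectedRegretLE E F O P μ q h (√(3 * T / (4 * h * K))) T
      (1 / theta q * √(3 * T / h * K)) := by
  have hT₀ : (0 : ℝ) < T := by exact_mod_cast hT
  have hbound := expectedRegretLE hP hq0 hq1 (by positivity : 0 < √(3 * T / (4 * h * K))) hh0 hh1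
    hreal hO
  exact ⟨hbound.1, hbound.2.trans
    (exploration_cost_add_regression_cost_le (theta_pos hq0 hq1) hh0 hT₀ hK hR)⟩

end Regret

end RiskCB

theorem theorem2 {X A S Φ : Type*} [MeasurableSpace X] [MeasurableSpace A] [MeasurableSpace S]
    [MeasurableSpace Φ]
    (E : RiskCB.Environment X A S) (F : RiskCB.FunctionClass Φ X A) (𝓕 : Set Φ)
    (O : RiskCB.RegressionOracle Φ X A) (P : RiskCB.OptimizationOracle Φ X A)
    (μ : Measure A) [IsProbabilityMeasure μ]
    (q : ℝ) (hq0 : 0 < q) (hq1 : q < 1)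
    (h : ℝ) (hh0 : 0 < h) (hh1 : h ≤ 1)
    (T : ℕ) (hT : 1 ≤ T) (R : ℝ)
    (hreal : E.Realizable F 𝓕 q T)
    (hO : O.HasRegretBound F 𝓕 q T R)
    (hP : P.IsAccurate F μ) :
    RiskCB.ExpectedRegretLE E F O P μ q h
        (Real.sqrt (3 * T / (h * (16 + 12 * RiskCB.theta q * (1 + R))))) T
        (1 / RiskCB.theta q *
          Real.sqrt (1 / h * (3 * T) * (4 + 3 * RiskCB.theta q * (1 + R)))) ∧
    (0 < R →
      RiskCB.ExpectedRegretLE E F O P μ q h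
        (Real.sqrt (3 * T / (4 * RiskCB.theta q * h * R))) T
        (Real.sqrt 3 * (1 / RiskCB.theta q * Real.sqrt (1 / h * T * R)))) := by
  have hθ := RiskCB.theta_pos hq0 hq1
  constructor
  · have hR := RiskCB.regretBound_nonneg P μ ⟨hq0.le, hq1.le⟩ hreal hO
    convert RiskCB.expectedRegretLE_sqrt (K := 4 + 3 * RiskCB.theta q * (1 + R)) hP hq0 hq1 hh0
      hh1 hT hreal hO (by positivity) (by nlinarith) using 3
    · ring
    · ring_nf
  · intro hR
    have hθ₁ : RiskCB.theta q ≤ 1 := (min_le_left _ _).trans hq1.le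
    have hbound := RiskCB.expectedRegretLE_sqrt hP hq0 hq1 hh0 hh1 hT hreal hO
      (mul_pos hθ hR) le_rfl
    rw [show 4 * RiskCB.theta q * h * R = 4 * h * (RiskCB.theta q * R) by ring]
    refine ⟨hbound.1, hbound.2.trans ?_⟩
    rw [mul_left_comm (√3), ← Real.sqrt_mul zero_le_three]
    refine mul_le_mul_of_nonneg_left (Real.sqrt_le_sqrt ?_) (by positivity)
    calc 3 * T / h * (RiskCB.theta q * R) ≤ 3 * T / h * R := by
          gcongr
          exact mul_le_of_le_one_left hR.le hθ₁
      _ = 3 * (1 / h * T * R) := by ring
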